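/- Let $\Gamma$ be a metric star graph: it is obtained from finitely many (at least one) compact intervals (edges) $e$ of lengths $L(e)\in(0,\infty)$ by gluing one end point of each edge to a common vertex $v_0$, while the other end points are distinct vertices of degree one. Let $\operatorname{dist}$ be the path metric on $\Gamma$ and $\operatorname{diam}\Gamma=\max\{\operatorname{dist}(p,q):p,q\in\Gamma\}$. Let $-\Delta_\Gamma$ be the Laplacian on $L^2(\Gamma)=\bigoplus_e L^2(0,L(e))$ with standard vertex conditions: it acts as $-f_e''$ on each edge $e$, and its domain consists of all functions $f$ which are continuous on $\Gamma$, whose restrictions $f_e$ belong to $H^2(0,L(e))$ for each edge $e$, and for which at each vertex the sum of the derivatives of $f$ along all edges incident to that vertex, taken in the direction towards the vertex, is zero (Kirchhoff condition). Let $\mu_2(\Gamma)$ be the smallest positive eigenvalue of $-\Delta_\Gamma$. Let $\psi\in\ker(-\Delta_\Gamma-\mu_2(\Gamma))$ be real-valued and nontrivial, and let $x,y\in\Gamma$ be such that $\psi$ takes its global maximum at $x$ and its global minimum at $y$. Then $$\operatorname{dist}(x,y)=\operatorname{diam}\Gamma .$$ -/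

import Mathlib

open Set MeasureTheory
open scoped ContDiff

noncomputable section

/-! ### Sobolev spaces on a bounded interval, through weak derivatives -/

/-- `g` is a weak derivative of `f` on the open interval `(0, ℓ)`. -/
def HasWeakDeriv (ℓ : ℝ) (f g : ℝ → ℝ) : Prop :=
  ∀ φ : ℝ → ℝ, ContDiff ℝ ∞ φ → HasCompactSupport φ → tsupport φ ⊆ Ioo 0 ℓ →
    ∫ x in Ioo 0 ℓ, f x * deriv φ x = - ∫ x in Ioo 0 ℓ, g x * φ x

/-- `f ∈ L²(0, ℓ)`. -/
def MemL2 (ℓ : ℝ) (f : ℝ → ℝ) : Prop :=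
  MemLp f 2 (volume.restrict (Ioo 0 ℓ))

/-- `f ∈ Hᵏ(0, ℓ)`. -/
def MemSobolev (ℓ : ℝ) : ℕ → (ℝ → ℝ) → Prop
  | 0, f => MemL2 ℓ f
  | k + 1, f => MemL2 ℓ f ∧ ∃ g, HasWeakDeriv ℓ f g ∧ MemSobolev ℓ k g

/-- `h ∈ L²(0, ℓ)` is the weak second derivative of `f`, the first one also being in `L²(0, ℓ)`.
(Weak derivatives are unique up to null sets, and `h` may be changed on a null set.) -/
def HasWeakSecondDeriv (ℓ : ℝ) (f h : ℝ → ℝ) : Prop :=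
  MemL2 ℓ h ∧ ∃ g, MemL2 ℓ g ∧ HasWeakDeriv ℓ f g ∧ HasWeakDeriv ℓ g h

/-! ### Metric graphs -/

/-- A discrete (multi)graph with vertex set `V` and edge set `E` (loops and parallel edges are
allowed), each edge `e` being oriented from `o e` to `t e` and having a length `L e > 0`. -/
structure MetricGraph (V E : Type*) where
  /-- the vertex from which an edge originates -/
  o : E → V
  /-- the vertex at which an edge terminates -/
  t : E → V
  /-- the length of an edge -/
  L : E → ℝ
  L_pos : ∀ e, 0 < L e

namespace MetricGraph

variable {V E : Type*} (G : MetricGraph V E)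

/-- The gluing of the intervals `[0, L e]` at the vertices. -/
inductive Glue : V ⊕ (Σ e : E, Icc (0 : ℝ) (G.L e)) → V ⊕ (Σ e : E, Icc (0 : ℝ) (G.L e)) → Prop
  | origin (e : E) : Glue (Sum.inr ⟨e, ⟨0, left_mem_Icc.2 (G.L_pos e).le⟩⟩) (Sum.inl (G.o e))
  | terminus (e : E) :
      Glue (Sum.inr ⟨e, ⟨G.L e, right_mem_Icc.2 (G.L_pos e).le⟩⟩) (Sum.inl (G.t e))

/-- The set of points of the metric graph: the vertices together with the intervals `[0, L e]`,
where `0` in `[0, L e]` is identified with `o e` and `L e` with `t e`. -/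
def Point : Type _ := Quot G.Glue

/-- A vertex, as a point of the metric graph. -/
def vertex (v : V) : G.Point := Quot.mk _ (Sum.inl v)

/-- The point with coordinate `s` on the edge `e`. -/
def edgePoint (e : E) (s : Icc (0 : ℝ) (G.L e)) : G.Point := Quot.mk _ (Sum.inr ⟨e, s⟩)

/-- `G.HasPath x y r`: there is a path of length `r` from `x` to `y`, composed of finitely many
segments, each of which lies in a single edge. -/
inductive HasPath : G.Point → G.Point → ℝ → Prop
  | refl (x : G.Point) : HasPath x x 0
  | step (e : E) (a b : Icc (0 : ℝ) (G.L e)) (y : G.Point) (r : ℝ)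
      (h : HasPath (G.edgePoint e b) y r) :
      HasPath (G.edgePoint e a) y (|(a : ℝ) - b| + r)

/-- The distance on a (connected) metric graph: the infimum of the lengths of paths. -/
def dist (x y : G.Point) : ℝ := sInf {r : ℝ | G.HasPath x y r}

/-- The set of all distances between two points. -/
def distances : Set ℝ := {d : ℝ | ∃ x y : G.Point, d = G.dist x y}

/-- The diameter of a (connected, finite) metric graph. -/
def diam : ℝ := sSup G.distances

/-- The restriction of a function to the edge `e`, as a function of the coordinate in `[0, L e]`
(continued constantly outside this interval). -/
def restrict (ψ : G.Point → ℝ) (e : E) : ℝ → ℝ :=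
  IccExtend (G.L_pos e).le fun s => ψ (G.edgePoint e s)

/-- `ψ ∈ C(Γ)`: `ψ` is continuous on each edge (and single-valued at the vertices, which is
automatic for a function of the points of the graph). -/
def MemC (ψ : G.Point → ℝ) : Prop := ∀ e, ContinuousOn (G.restrict ψ e) (Icc 0 (G.L e))

/-- `ψ ∈ H̃ᵏ(Γ)`: each restriction to an edge is in `Hᵏ(0, L e)`. -/
def MemHtilde (k : ℕ) (ψ : G.Point → ℝ) : Prop := ∀ e, MemSobolev (G.L e) k (G.restrict ψ e)

/-- `H¹(Γ) = H̃¹(Γ) ∩ C(Γ)`. -/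
def MemH1 (ψ : G.Point → ℝ) : Prop := G.MemHtilde 1 ψ ∧ G.MemC ψ

variable [Fintype E] [DecidableEq V]

/-- The degree of a vertex; loops count twice. -/
def degree (v : V) : ℕ :=
  (Finset.univ.filter fun e => G.o e = v).card + (Finset.univ.filter fun e => G.t e = v).card

/-- The sum `∂_ν ψ (v)` of the derivatives of `ψ` at `v`, taken in the direction pointing towards
`v`, over all edges incident to `v`. For continuous `ψ` in `H̃²(Γ)` the restrictions to the edges
are continuously differentiable up to the end points, with the one-sided derivatives used here. -/
def normalDeriv (ψ : G.Point → ℝ) (v : V) : ℝ :=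
  (∑ e ∈ Finset.univ.filter (fun e => G.t e = v),
      derivWithin (G.restrict ψ e) (Icc 0 (G.L e)) (G.L e)) -
    ∑ e ∈ Finset.univ.filter (fun e => G.o e = v),
      derivWithin (G.restrict ψ e) (Icc 0 (G.L e)) 0

/-- The domain of the Laplacian with standard (continuity and Kirchhoff) vertex conditions. -/
def MemDomain (ψ : G.Point → ℝ) : Prop :=
  G.MemH1 ψ ∧ G.MemHtilde 2 ψ ∧ ∀ v, G.normalDeriv ψ v = 0

/-- The graph of the operator `-Δ`: `ψ` is in the domain and `-Δ ψ = u`, that is, the weak second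
derivative of `ψ` on each edge `e` is `-u e`. -/
def NegLaplacian (ψ : G.Point → ℝ) (u : E → ℝ → ℝ) : Prop :=
  G.MemDomain ψ ∧ ∀ e, HasWeakSecondDeriv (G.L e) (G.restrict ψ e) fun x => - u e x

/-- `ψ ∈ ker (-Δ - μ)`. -/
def MemKer (μ : ℝ) (ψ : G.Point → ℝ) : Prop :=
  G.NegLaplacian ψ fun e x => μ * G.restrict ψ e x

/-- `μ` is an eigenvalue of `-Δ`. -/
def IsEigenvalue (μ : ℝ) : Prop := ∃ ψ : G.Point → ℝ, ψ ≠ 0 ∧ G.MemKer μ ψ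

/-- The smallest positive eigenvalue of `-Δ`. (For connected graphs the lowest eigenvalue `0` is
simple, so that this is the second eigenvalue, counted with multiplicities.) -/
def mu2 : ℝ := sInf {μ : ℝ | 0 < μ ∧ G.IsEigenvalue μ}

/-- Star graphs: there is a star vertex `v₀` whose degree is the number of edges, each edge is
incident to `v₀`, and all other vertices have degree one. -/
def IsStar : Prop :=
  ∃ v₀ : V, G.degree v₀ = Fintype.card E ∧ (∀ e, G.o e = v₀ ∨ G.t e = v₀) ∧
    ∀ v, v ≠ v₀ → G.degree v = 1

end MetricGraph

end

/-! ### Weak derivatives on an interval -/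

/-! On an edge `e` let `τ` be the distance to the star vertex and `k = √μ₂`. The Neumann condition
at the leaf forces `ψ = c e * cos (k (L e - τ))`. Continuity and Kirchhoff at the centre become `c e
* cos (k L e) = a` and `∑ c e * sin (k L e) = 0` (`IsSecular`). If `L₁ ≥ m` are the two largest
lengths (`m = 0` for a single edge), the diameter is `L₁ + m`.

Two bounds carry the proof. `pi_div_two_le_of_isSecular` gives `π/2 ≤ k L₁`, and `exists_isSecular`
produces an eigenvalue low enough that `k (L₁ + m) ≤ π`. If `k L₁ = π/2`, then `a = 0`, only edges
of maximal length carry `ψ`, and the extrema are leaves of two such edges. If `k L₁ > π/2`, every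
other edge has `k L e < π/2`. Up to sign `a > 0`, so `c` is negative on the longest edge and
positive on the others. The minimum is then the leaf of the longest edge. The maximum is the leaf of
a second longest edge, because `c e = a / cos (k L e)` grows with `L e`; with a single edge it is
the centre. -/

theorem integrableOn_Ioo_mul_of_continuous {ℓ : ℝ} {u v : ℝ → ℝ}
    (hu : IntegrableOn u (Ioo 0 ℓ)) (hv : Continuous v) :
    IntegrableOn (fun x => u x * v x) (Ioo 0 ℓ) := by
  rw [← integrableOn_Icc_iff_integrableOn_Ioo] at hu ⊢
  exact hu.mul_continuousOn hv.continuousOn isCompact_Icc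

/-- The primitive starting at `0` vanishes left of the support, and right of it because the total
integral is zero. -/
theorem exists_primitive_of_integral_eq_zero {ℓ : ℝ} (hℓ : 0 < ℓ) {η : ℝ → ℝ}
    (hη : ContDiff ℝ ∞ η) (hc : HasCompactSupport η) (hs : tsupport η ⊆ Ioo 0 ℓ)
    (h0 : ∫ x, η x = 0) :
    ∃ φ : ℝ → ℝ, ContDiff ℝ ∞ φ ∧ HasCompactSupport φ ∧ tsupport φ ⊆ Ioo 0 ℓ ∧
      deriv φ = η := by
  -- The midpoint is added only to keep the compact set nonempty when `η = 0`.
  have hK : IsCompact (tsupport η ∪ {ℓ / 2}) := hc.isCompact.union isCompact_singleton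
  have hKn : (tsupport η ∪ {ℓ / 2}).Nonempty := ⟨ℓ / 2, by simp⟩
  have hKs : tsupport η ∪ {ℓ / 2} ⊆ Ioo 0 ℓ :=
    union_subset hs (by rintro x rfl; constructor <;> linarith)
  obtain ⟨a, haK, ha⟩ := hK.exists_isLeast hKn
  obtain ⟨b, hbK, hb⟩ := hK.exists_isGreatest hKn
  have hz : ∀ x, x ∉ Icc a b → η x = 0 := fun x hx => by
    by_contra hne
    exact hx ⟨ha (Or.inl (subset_tsupport _ hne)), hb (Or.inl (subset_tsupport _ hne))⟩
  set φ : ℝ → ℝ := fun x => ∫ t in (0 : ℝ)..x, η t with hφ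
  have hder : ∀ x, HasDerivAt φ (η x) x := fun x =>
    intervalIntegral.integral_hasDerivAt_right (hη.continuous.intervalIntegrable _ _)
      (hη.continuous.stronglyMeasurableAtFilter _ _) hη.continuous.continuousAt
  have hd : deriv φ = η := funext fun x => (hder x).deriv
  have hleft : ∀ x < a, φ x = 0 := fun x hx => by
    have : ∀ t ∈ uIcc 0 x, η t = 0 := fun t ht => hz t fun h => by
      rcases le_total 0 x with h' | h'
      · rw [uIcc_of_le h'] at ht; linarith [ht.2, h.1]
      · rw [uIcc_of_ge h'] at ht; linarith [ht.2, h.1, (hKs haK).1]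
    rw [hφ]
    simp only
    rw [intervalIntegral.integral_congr this]
    simp
  have hright : ∀ x, b < x → φ x = 0 := fun x hx => by
    have hx0 : 0 ≤ x := by linarith [(hKs hbK).1]
    have : φ x = ∫ t, η t := by
      rw [hφ]
      simp only
      rw [intervalIntegral.integral_of_le hx0]
      refine setIntegral_eq_integral_of_forall_compl_eq_zero fun t ht => hz t fun h => ht ?_
      exact ⟨by linarith [h.1, (hKs haK).1], by linarith [h.2]⟩
    rw [this, h0]
  have hts : tsupport φ ⊆ Icc a b := by
    refine closure_minimal (fun x hx => ?_) isClosed_Icc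
    by_contra h
    rw [mem_Icc, not_and_or, not_le, not_le] at h
    rcases h with h | h
    · exact hx (hleft x h)
    · exact hx (hright x h)
  refine ⟨φ, ?_, HasCompactSupport.of_support_subset_isCompact isCompact_Icc
    ((subset_tsupport φ).trans hts), hts.trans fun x hx => ?_, hd⟩
  · rw [contDiff_infty_iff_deriv, hd]
    exact ⟨fun x => (hder x).differentiableAt, hη⟩
  · exact ⟨(hKs haK).1.trans_le hx.1, hx.2.trans_lt (hKs hbK).2⟩

/-- The lemma of du Bois-Reymond. -/
theorem ae_eq_const_of_forall_integral_mul_deriv_eq_zero {ℓ : ℝ} (hℓ : 0 < ℓ) {u : ℝ → ℝ}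
    (hu : IntegrableOn u (Ioo 0 ℓ))
    (h : ∀ φ : ℝ → ℝ, ContDiff ℝ ∞ φ → HasCompactSupport φ → tsupport φ ⊆ Ioo 0 ℓ →
      ∫ x in Ioo 0 ℓ, u x * deriv φ x = 0) :
    ∃ c : ℝ, ∀ᵐ x ∂volume.restrict (Ioo 0 ℓ), u x = c := by
  let B : ContDiffBump (ℓ / 2) := ⟨ℓ / 8, ℓ / 4, by positivity, by linarith⟩
  set ρ : ℝ → ℝ := B.normed volume with hρ
  have hρ1 : ∫ x, ρ x = 1 := B.integral_normed
  have hρd : ContDiff ℝ ∞ ρ := B.contDiff_normed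
  have hρc : HasCompactSupport ρ := B.hasCompactSupport_normed
  have hρs : tsupport ρ ⊆ Ioo 0 ℓ := by
    rw [hρ, B.tsupport_normed_eq, Real.closedBall_eq_Icc]
    intro x hx
    have h1 : ℓ / 2 - ℓ / 4 ≤ x := hx.1
    have h2 : x ≤ ℓ / 2 + ℓ / 4 := hx.2
    constructor <;> linarith
  set c : ℝ := ∫ x in Ioo 0 ℓ, u x * ρ x with hcdef
  refine ⟨c, ?_⟩
  have key : ∀ᵐ x, x ∈ Ioo 0 ℓ → u x - c = 0 := by
    refine isOpen_Ioo.ae_eq_zero_of_integral_contDiff_smul_eq_zero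
      ((hu.sub (integrableOn_const (by simp))).locallyIntegrableOn) fun η hη hηc hηs => ?_
    -- `η - m ρ` has mean zero, so it is the derivative of an admissible test function; this yields
    -- `∫ u η = c ∫ η`.
    set m : ℝ := ∫ x, η x with hm
    have hint : Integrable η := hη.continuous.integrable_of_hasCompactSupport hηc
    have hintρ : Integrable ρ := hρd.continuous.integrable_of_hasCompactSupport hρc
    have hsub : tsupport (fun x => η x - m * ρ x) ⊆ tsupport η ∪ tsupport ρ := by
      refine closure_minimal (fun x hx => ?_) ((isClosed_tsupport _).union (isClosed_tsupport _))
      by_contra hn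
      rw [mem_union, not_or] at hn
      exact hx (by simp [image_eq_zero_of_notMem_tsupport hn.1,
        image_eq_zero_of_notMem_tsupport hn.2])
    obtain ⟨φ, h1, h2, h3, h4⟩ := exists_primitive_of_integral_eq_zero hℓ
      (η := fun x => η x - m * ρ x) (hη.sub (contDiff_const.mul hρd))
      (HasCompactSupport.of_support_subset_isCompact (hηc.isCompact.union hρc.isCompact)
        ((subset_tsupport _).trans hsub))
      (hsub.trans (union_subset hηs hρs))
      (by rw [integral_sub hint (hintρ.const_mul m), integral_const_mul, hρ1]; simp [hm])
    have h5 := h φ h1 h2 h3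
    rw [h4] at h5
    have h6 : ∫ x in Ioo 0 ℓ, u x * η x = m * c := by
      have e : (fun x => u x * (η x - m * ρ x)) = fun x => u x * η x - m * (u x * ρ x) := by
        funext x; ring
      rw [e, integral_sub (integrableOn_Ioo_mul_of_continuous hu hη.continuous)
        ((integrableOn_Ioo_mul_of_continuous hu hρd.continuous).const_mul m),
        integral_const_mul] at h5
      linarith
    have h7 : ∫ x in Ioo 0 ℓ, η x = m :=
      setIntegral_eq_integral_of_forall_compl_eq_zero fun x hx =>
        image_eq_zero_of_notMem_tsupport fun h => hx (hηs h)
    have h8 : ∫ x, η x • (u x - c) = ∫ x in Ioo 0 ℓ, η x • (u x - c) :=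
      (setIntegral_eq_integral_of_forall_compl_eq_zero fun x hx => by
        rw [image_eq_zero_of_notMem_tsupport fun h => hx (hηs h), zero_smul]).symm
    have e : (fun x => η x • (u x - c)) = fun x => u x * η x - c * η x := by
      funext x; simp only [smul_eq_mul]; ring
    rw [h8, e, integral_sub (integrableOn_Ioo_mul_of_continuous hu hη.continuous)
      (hint.integrableOn.const_mul c), integral_const_mul, h6, h7]
    ring
  rw [ae_restrict_iff' measurableSet_Ioo]
  filter_upwards [key] with x hx hxm
  linarith [hx hxm]

theorem MemL2.integrableOn {ℓ : ℝ} {f : ℝ → ℝ} (hf : MemL2 ℓ f) : IntegrableOn f (Ioo 0 ℓ) :=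
  MemLp.integrable one_le_two hf

/-- Continuous weak solutions of `f'' = - k² f` are trigonometric. -/
theorem HasWeakSecondDeriv.exists_eq_cos_add_sin {ℓ k : ℝ} (hℓ : 0 < ℓ) (hk : 0 < k)
    {f : ℝ → ℝ} (hf : ContinuousOn f (Icc 0 ℓ))
    (h : HasWeakSecondDeriv ℓ f fun x => -(k ^ 2 * f x)) :
    ∃ A B : ℝ, ∀ x ∈ Icc 0 ℓ, f x = A * Real.cos (k * x) + B * Real.sin (k * x) := by
  obtain ⟨-, g, hg, hfg, hgh⟩ := h
  have hgi := hg.integrableOn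
  have hfi : IntegrableOn f (Ioo 0 ℓ) := by
    rw [← integrableOn_Icc_iff_integrableOn_Ioo]
    exact hf.integrableOn_compact isCompact_Icc
  have hcos : ContDiff ℝ ∞ fun x => Real.cos (k * x) :=
    Real.contDiff_cos.comp (contDiff_const.mul contDiff_id)
  have hsin : ContDiff ℝ ∞ fun x => Real.sin (k * x) :=
    Real.contDiff_sin.comp (contDiff_const.mul contDiff_id)
  have dcos : ∀ x, HasDerivAt (fun x => Real.cos (k * x)) (-(k * Real.sin (k * x))) x :=
    fun x => by simpa [mul_comm] using ((hasDerivAt_id x).const_mul k).cos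
  have dsin : ∀ x, HasDerivAt (fun x => Real.sin (k * x)) (k * Real.cos (k * x)) x :=
    fun x => by simpa [mul_comm] using ((hasDerivAt_id x).const_mul k).sin
  -- For `p' = -k q`, `q' = k p` the Wronskian-like quantity `f' p + k f q` has weak derivative
  -- zero. The pairs `(cos, sin)` and `(sin, -cos)` give two constants, and eliminating `f'` solves
  -- for `f` without any prior regularity of `g`.
  have main : ∀ (p q : ℝ → ℝ), ContDiff ℝ ∞ p → ContDiff ℝ ∞ q →
      (∀ x, HasDerivAt p (-(k * q x)) x) → (∀ x, HasDerivAt q (k * p x) x) →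
      ∃ c : ℝ, ∀ᵐ x ∂volume.restrict (Ioo 0 ℓ), g x * p x + k * (f x * q x) = c := by
    intro p q hp hq dp dq
    have hgp := integrableOn_Ioo_mul_of_continuous hgi hp.continuous
    have hfq := integrableOn_Ioo_mul_of_continuous hfi hq.continuous
    refine ae_eq_const_of_forall_integral_mul_deriv_eq_zero hℓ (hgp.add (hfq.const_mul k)) ?_
    intro φ hφ hφc hφs
    have hφ' : Continuous (deriv φ) := hφ.continuous_deriv (by simp)
    have dφ : ∀ x, HasDerivAt φ (deriv φ x) x := fun x =>
      (hφ.differentiable (by simp) x).hasDerivAt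
    have t1 := hgh (fun x => p x * φ x) (hp.mul hφ) hφc.mul_left
      ((tsupport_mul_subset_right).trans hφs)
    have t2 := hfg (fun x => q x * φ x) (hq.mul hφ) hφc.mul_left
      ((tsupport_mul_subset_right).trans hφs)
    have e1 : deriv (fun x => p x * φ x) = fun x => p x * deriv φ x - k * (q x * φ x) := by
      funext x
      exact ((dp x).mul (dφ x)).deriv.trans (by ring)
    have e2 : deriv (fun x => q x * φ x) = fun x => q x * deriv φ x + k * (p x * φ x) := by
      funext x
      exact ((dq x).mul (dφ x)).deriv.trans (by ring)
    have i1 : IntegrableOn (fun x => g x * (p x * deriv φ x)) (Ioo 0 ℓ) :=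
      integrableOn_Ioo_mul_of_continuous hgi (hp.continuous.mul hφ')
    have i2 : IntegrableOn (fun x => g x * (q x * φ x)) (Ioo 0 ℓ) :=
      integrableOn_Ioo_mul_of_continuous hgi (hq.continuous.mul hφ.continuous)
    have i3 : IntegrableOn (fun x => f x * (q x * deriv φ x)) (Ioo 0 ℓ) :=
      integrableOn_Ioo_mul_of_continuous hfi (hq.continuous.mul hφ')
    have i4 : IntegrableOn (fun x => f x * (p x * φ x)) (Ioo 0 ℓ) :=
      integrableOn_Ioo_mul_of_continuous hfi (hp.continuous.mul hφ.continuous)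
    have s1 : (fun x => g x * (p x * deriv φ x - k * (q x * φ x))) =
        fun x => g x * (p x * deriv φ x) - k * (g x * (q x * φ x)) := by funext x; ring
    have s2 : (fun x => f x * (q x * deriv φ x + k * (p x * φ x))) =
        fun x => f x * (q x * deriv φ x) + k * (f x * (p x * φ x)) := by funext x; ring
    have s3 : (fun x => -(k ^ 2 * f x) * (p x * φ x)) =
        fun x => (-k ^ 2) * (f x * (p x * φ x)) := by funext x; ring
    have s4 : (fun x => (g x * p x + k * (f x * q x)) * deriv φ x) =
        fun x => g x * (p x * deriv φ x) + k * (f x * (q x * deriv φ x)) := by funext x; ring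
    rw [e1, s1, s3, integral_sub i1 (i2.const_mul k), integral_const_mul,
      integral_const_mul] at t1
    rw [e2, s2, integral_add i3 (i4.const_mul k), integral_const_mul] at t2
    rw [s4, integral_add i1 (i3.const_mul k), integral_const_mul]
    linear_combination t1 + k * t2
  obtain ⟨c₁, h₁⟩ := main _ _ hcos hsin dcos dsin
  obtain ⟨c₂, h₂⟩ := main (fun x => Real.sin (k * x)) (fun x => -Real.cos (k * x)) hsin hcos.neg
    (fun x => by simpa using dsin x) (fun x => by simpa using! (dcos x).neg)
  refine ⟨-c₂ / k, c₁ / k, ?_⟩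
  refine Measure.eqOn_Icc_of_ae_eq volume hℓ.ne ?_ hf (by fun_prop)
  rw [← restrict_Ioo_eq_restrict_Icc]
  filter_upwards [h₁, h₂] with x hx₁ hx₂
  have := Real.sin_sq_add_cos_sq (k * x)
  field_simp
  rw [← hx₁, ← hx₂]
  linear_combination (-(k * f x)) * this

/-! ### The secular equation -/

/-- `c e * cos (k * s)`, where `s` is the distance to the leaf of the edge `e`, defines a nonzero
function on the star with edge lengths `L` satisfying the standard vertex conditions, with value
`a` at the star vertex. -/
structure IsSecular {E : Type*} [Fintype E] (L : E → ℝ) (k a : ℝ) (c : E → ℝ) : Prop where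
  ne_zero : c ≠ 0
  cos_eq : ∀ e, c e * Real.cos (k * L e) = a
  sum_sin : ∑ e, c e * Real.sin (k * L e) = 0

/-- `e₁` is an edge of maximal length, and `m` is the second largest length (zero if there is
only one edge). -/
structure IsTopTwo {E : Type*} (L : E → ℝ) (e₁ : E) (m : ℝ) : Prop where
  le_first : m ≤ L e₁
  le_second : ∀ e, e ≠ e₁ → L e ≤ m
  second : (m = 0 ∧ ∀ e, e = e₁) ∨ ∃ e₂, e₂ ≠ e₁ ∧ L e₂ = m

theorem exists_isTopTwo {E : Type*} [Fintype E] [Nonempty E] {L : E → ℝ} (hL : ∀ e, 0 < L e) :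
    ∃ e₁ m, IsTopTwo L e₁ m := by
  classical
  obtain ⟨e₁, -, h₁⟩ := Finset.exists_max_image Finset.univ L Finset.univ_nonempty
  by_cases hne : ((Finset.univ : Finset E).erase e₁).Nonempty
  · obtain ⟨e₂, h₂, h₃⟩ := Finset.exists_max_image _ L hne
    refine ⟨e₁, L e₂, h₁ _ (Finset.mem_univ _), fun e he => h₃ e (by simpa using he),
      Or.inr ⟨e₂, by simpa using h₂, rfl⟩⟩
  · have h : ∀ e, e = e₁ := fun e => by
      by_contra he
      exact hne ⟨e, by simpa using he⟩
    exact ⟨e₁, 0, (hL e₁).le, fun e he => absurd (h e) he, Or.inl ⟨rfl, h⟩⟩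

namespace IsTopTwo

variable {E : Type*} {L : E → ℝ} {e₁ : E} {m : ℝ}

theorem le (h : IsTopTwo L e₁ m) (e : E) : L e ≤ L e₁ := by
  by_cases he : e = e₁
  · rw [he]
  · exact (h.le_second e he).trans h.le_first

theorem nonneg (h : IsTopTwo L e₁ m) (hL : ∀ e, 0 < L e) : 0 ≤ m := by
  rcases h.second with ⟨h, -⟩ | ⟨e₂, -, h⟩
  · exact h.ge
  · rw [← h]; exact (hL e₂).le

theorem add_le (h : IsTopTwo L e₁ m) {e f : E} (hef : e ≠ f) : L e + L f ≤ L e₁ + m := by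
  by_cases he : e = e₁
  · subst he; linarith [h.le_second f hef.symm]
  · linarith [h.le_second e he, h.le f]

variable [Fintype E]

/-- This bounds `μ₂` from above. If the two largest lengths agree, a function supported on two
longest edges works; otherwise all `cos (k L e)` are nonzero at the chosen `k`, and the secular
equation is `∑ tan (k L e) = 0`. -/
theorem exists_isSecular (h : IsTopTwo L e₁ m) (hL : ∀ e, 0 < L e) :
    ∃ k a c, 0 < k ∧ k * (L e₁ + m) ≤ Real.pi ∧ IsSecular L k a c := by
  classical
  have hπ := Real.pi_pos
  have hm := h.nonneg hL
  have hL1 := hL e₁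
  rcases h.le_first.eq_or_lt with heq | hlt
  · obtain ⟨hm0, -⟩ | ⟨e₂, h21, h2m⟩ := h.second
    · linarith
    have hk : Real.pi / (2 * L e₁) * L e₁ = Real.pi / 2 := by field_simp
    have hL2 : L e₂ = L e₁ := h2m.trans heq
    refine ⟨Real.pi / (2 * L e₁), 0, Pi.single e₁ 1 - Pi.single e₂ 1, by positivity,
      by rw [heq, mul_add, hk]; linarith, ?_, ?_, ?_⟩
    · intro h0
      have := congrFun h0 e₁
      simp [h21.symm] at this
    · intro e
      by_cases he : e = e₁
      · rw [he, hk, Real.cos_pi_div_two, mul_zero]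
      by_cases he2 : e = e₂
      · rw [he2, hL2, hk, Real.cos_pi_div_two, mul_zero]
      simp [he, he2]
    · simp [Pi.single_apply, sub_mul, Finset.sum_sub_distrib, hL2]
  · set lo := Real.pi / (2 * L e₁) with hlo
    set hi := Real.pi / (L e₁ + m) with hhi
    have hlo1 : lo * L e₁ = Real.pi / 2 := by rw [hlo]; field_simp
    have hhi1 : hi * (L e₁ + m) = Real.pi := by rw [hhi]; field_simp
    have hlo0 : 0 < lo := by positivity
    have hhi0 : 0 < hi := by positivity
    have hle : lo ≤ hi := by
      rw [hlo, hhi]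
      apply div_le_div_of_nonneg_left hπ.le <;> linarith
    -- The strict inequality `m < L e₁` keeps the tangents of all other edges finite on the whole
    -- interval.
    have hhim : hi * m < Real.pi / 2 := by nlinarith
    have hsmall : ∀ k ∈ Icc lo hi, ∀ e, e ≠ e₁ → 0 < k * L e ∧ k * L e < Real.pi / 2 := by
      intro k hk e he
      have h0 : 0 < k := hlo0.trans_le hk.1
      have h1 := h.le_second e he
      have h2 := hL e
      refine ⟨mul_pos h0 h2, lt_of_le_of_lt ?_ hhim⟩
      exact mul_le_mul hk.2 h1 h2.le hhi0.le
    -- This is `∑ tan (k L e)` multiplied by `cos (k L e₁)`, which removes the pole at `k = lo`.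
    set F : ℝ → ℝ := fun k => Real.sin (k * L e₁) + Real.cos (k * L e₁) *
      ∑ e ∈ Finset.univ.erase e₁, Real.tan (k * L e) with hF
    have hcont : ContinuousOn F (Icc lo hi) := by
      refine ContinuousOn.add (by fun_prop) (ContinuousOn.mul (by fun_prop) ?_)
      refine continuousOn_finsetSum _ fun e he => ?_
      refine Real.continuousOn_tan.comp (by fun_prop) fun k hk => ?_
      obtain ⟨h1, h2⟩ := hsmall k hk e (Finset.ne_of_mem_erase he)
      exact (Real.cos_pos_of_mem_Ioo ⟨by linarith, h2⟩).ne'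
    have hFlo : F lo = 1 := by simp [hF, hlo1]
    have hFhi : F hi ≤ 0 := by
      have hang : hi * L e₁ = Real.pi - hi * m := by linarith
      have htan : ∀ e ∈ Finset.univ.erase e₁, 0 ≤ Real.tan (hi * L e) := fun e he => by
        obtain ⟨h1, h2⟩ := hsmall hi ⟨hle, le_rfl⟩ e (Finset.ne_of_mem_erase he)
        exact Real.tan_nonneg_of_nonneg_of_le_pi_div_two h1.le h2.le
      have hsum : Real.tan (hi * m) ≤ ∑ e ∈ Finset.univ.erase e₁, Real.tan (hi * L e) := by
        obtain ⟨hm0, -⟩ | ⟨e₂, h21, h2m⟩ := h.second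
        · rw [hm0]; simpa using Finset.sum_nonneg htan
        · rw [← h2m]
          exact Finset.single_le_sum (f := fun e => Real.tan (hi * L e)) htan
            (Finset.mem_erase.2 ⟨h21, Finset.mem_univ _⟩)
      have hcos : 0 < Real.cos (hi * m) :=
        Real.cos_pos_of_mem_Ioo ⟨by have := mul_nonneg hhi0.le hm; linarith, hhim⟩
      have := Real.tan_mul_cos hcos.ne'
      simp only [hF]
      rw [hang, Real.sin_pi_sub, Real.cos_pi_sub]
      nlinarith
    obtain ⟨k, hk, hFk⟩ := intermediate_value_Icc' hle hcont ⟨hFhi, by rw [hFlo]; norm_num⟩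
    have hk0 : 0 < k := hlo0.trans_le hk.1
    -- `F lo = 1` excludes the left end point, the only place in the interval where `cos (k L e₁)`
    -- vanishes.
    have hklo : lo < k := lt_of_le_of_ne hk.1 fun hh => by
      rw [← hh, hFlo] at hFk; norm_num at hFk
    have hcos1 : Real.cos (k * L e₁) ≠ 0 := by
      refine (Real.cos_neg_of_pi_div_two_lt_of_lt ?_ ?_).ne
      · rw [← hlo1]; exact mul_lt_mul_of_pos_right hklo hL1
      · have : k * L e₁ ≤ hi * (L e₁ + m) :=
          mul_le_mul hk.2 (by linarith) hL1.le hhi0.le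
        linarith
    have hcos : ∀ e, Real.cos (k * L e) ≠ 0 := fun e => by
      by_cases he : e = e₁
      · rw [he]; exact hcos1
      · obtain ⟨h1, h2⟩ := hsmall k hk e he
        exact (Real.cos_pos_of_mem_Ioo ⟨by linarith, h2⟩).ne'
    refine ⟨k, 1, fun e => (Real.cos (k * L e))⁻¹, hk0, ?_, ?_, fun e =>
      inv_mul_cancel₀ (hcos e), ?_⟩
    · rw [← hhi1]; exact mul_le_mul_of_nonneg_right hk.2 (by linarith)
    · intro h0
      exact inv_ne_zero hcos1 (congrFun h0 e₁)
    · have e1 : ∀ e, (Real.cos (k * L e))⁻¹ * Real.sin (k * L e) = Real.tan (k * L e) :=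
        fun e => by rw [Real.tan_eq_sin_div_cos]; ring
      simp only [e1]
      rw [← Finset.add_sum_erase _ _ (Finset.mem_univ e₁)]
      have h1 := Real.tan_mul_cos hcos1
      have : Real.cos (k * L e₁) * (Real.tan (k * L e₁) +
          ∑ e ∈ Finset.univ.erase e₁, Real.tan (k * L e)) = 0 := by
        rw [← hFk, hF]
        linear_combination h1
      exact (mul_eq_zero.1 this).resolve_left hcos1

/-- If all angles were below `π/2`, multiplying the sine sum by `a` would give a vanishing sum of
the nonnegative terms `c e ^ 2 * cos * sin`, hence `c = 0`. -/
theorem pi_div_two_le_of_isSecular (h : IsTopTwo L e₁ m) (hL : ∀ e, 0 < L e) {k a : ℝ} {c : E → ℝ}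
    (hk : 0 < k) (hs : IsSecular L k a c) : Real.pi / 2 ≤ k * L e₁ := by
  by_contra! hlt
  have hang : ∀ e, 0 < k * L e ∧ k * L e < Real.pi / 2 := fun e =>
    ⟨mul_pos hk (hL e), (mul_le_mul_of_nonneg_left (h.le e) hk.le).trans_lt hlt⟩
  have hcos : ∀ e, 0 < Real.cos (k * L e) := fun e =>
    Real.cos_pos_of_mem_Ioo ⟨by linarith [(hang e).1, Real.pi_pos], (hang e).2⟩
  have hsin : ∀ e, 0 < Real.sin (k * L e) := fun e =>
    Real.sin_pos_of_pos_of_lt_pi (hang e).1 (by linarith [(hang e).2, Real.pi_pos])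
  have hterm : ∀ e, a * (c e * Real.sin (k * L e)) =
      c e ^ 2 * (Real.cos (k * L e) * Real.sin (k * L e)) := fun e => by
    rw [← hs.cos_eq e]; ring
  have hsum : ∑ e, c e ^ 2 * (Real.cos (k * L e) * Real.sin (k * L e)) = 0 := by
    rw [← Finset.sum_congr rfl fun e _ => hterm e, ← Finset.mul_sum, hs.sum_sin, mul_zero]
  refine hs.ne_zero (funext fun e => ?_)
  have h0 := (Finset.sum_eq_zero_iff_of_nonneg (fun e _ =>
    mul_nonneg (sq_nonneg (c e)) (mul_pos (hcos e) (hsin e)).le)).1 hsum e (Finset.mem_univ e)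
  have := (mul_eq_zero.1 h0).resolve_right (mul_pos (hcos e) (hsin e)).ne'
  simpa using this

end IsTopTwo

/-! ### Star graphs in radial coordinates -/

namespace MetricGraph

variable {V E : Type*} {G : MetricGraph V E}

theorem HasPath.nonneg {p q : G.Point} {r : ℝ} (h : G.HasPath p q r) : 0 ≤ r := by
  induction h with
  | refl => exact le_rfl
  | step e a b y r h ih => positivity

theorem dist_le {p q : G.Point} {r : ℝ} (h : G.HasPath p q r) : G.dist p q ≤ r :=
  csInf_le ⟨0, fun _ h => HasPath.nonneg h⟩ h

theorem restrict_of_mem (ψ : G.Point → ℝ) (e : E) {s : ℝ} (hs : s ∈ Icc 0 (G.L e)) :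
    G.restrict ψ e s = ψ (G.edgePoint e ⟨s, hs⟩) :=
  IccExtend_of_mem _ _ hs

variable [DecidableEq V]

/-- The end point of `e` which is not `v₀`, for an edge `e` of a star with star vertex `v₀`. -/
def leaf (G : MetricGraph V E) (v₀ : V) (e : E) : V := if G.o e = v₀ then G.t e else G.o e

/-- The graph is a star with star vertex `v₀`. -/
structure IsStarAt (G : MetricGraph V E) (v₀ : V) : Prop where
  edge : ∀ e, G.o e = v₀ ∧ G.t e ≠ v₀ ∨ G.o e ≠ v₀ ∧ G.t e = v₀
  existsUnique_leaf : ∀ v, v ≠ v₀ → ∃! e, G.leaf v₀ e = v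

theorem degree_eq_sum [Fintype E] (v : V) : G.degree v =
    ∑ e, ((if G.o e = v then 1 else 0) + (if G.t e = v then 1 else 0)) := by
  rw [degree, Finset.card_filter, Finset.card_filter, Finset.sum_add_distrib]

theorem IsStar.exists_isStarAt [Fintype E] (hG : G.IsStar) : ∃ v₀, G.IsStarAt v₀ := by
  obtain ⟨v₀, hdeg, hinc, hleaf⟩ := hG
  have hone : ∀ e ∈ (Finset.univ : Finset E), (1 : ℕ) =
      (if G.o e = v₀ then 1 else 0) + (if G.t e = v₀ then 1 else 0) := by
    -- Each edge contributes at least one to the degree of `v₀`, and the total is the number of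
    -- edges; so each contributes exactly one, and loops are excluded.
    refine (Finset.sum_eq_sum_iff_of_le fun e _ => ?_).1 ?_
    · rcases hinc e with h | h <;> simp [h]
    · rw [← degree_eq_sum, hdeg]; simp
  have hedge : ∀ e, G.o e = v₀ ∧ G.t e ≠ v₀ ∨ G.o e ≠ v₀ ∧ G.t e = v₀ := fun e => by
    have h := hone e (Finset.mem_univ e)
    by_cases h1 : G.o e = v₀ <;> by_cases h2 : G.t e = v₀ <;> simp [h1, h2] at h ⊢
  refine ⟨v₀, hedge, fun v hv => ?_⟩
  have hd := hleaf v hv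
  have hterm : ∀ e, (if G.o e = v then 1 else 0) + (if G.t e = v then 1 else 0) =
      if G.leaf v₀ e = v then 1 else 0 := fun e => by
    rcases hedge e with ⟨h1, h2⟩ | ⟨h1, h2⟩
    · simp [leaf, h1, hv.symm]
    · simp [leaf, h1, h2, hv.symm]
  rw [degree_eq_sum, Finset.sum_congr rfl fun e _ => hterm e, ← Finset.card_filter,
    Finset.card_eq_one] at hd
  obtain ⟨e, he⟩ := hd
  refine ⟨e, ?_, fun f hf => ?_⟩
  · have : e ∈ Finset.univ.filter fun e => G.leaf v₀ e = v := by simp [he]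
    simpa using this
  · have : f ∈ Finset.univ.filter fun e => G.leaf v₀ e = v := by simpa using hf
    rw [he] at this
    simpa using this

/-- The conversion between the coordinate on `e` and the distance to `v₀`. -/
def flip (G : MetricGraph V E) (v₀ : V) (e : E) (s : ℝ) : ℝ :=
  if G.o e = v₀ then s else G.L e - s

theorem flip_flip (v₀ : V) (e : E) (s : ℝ) : G.flip v₀ e (G.flip v₀ e s) = s := by
  unfold flip; split_ifs <;> ring

theorem flip_mem (v₀ : V) (e : E) {s : ℝ} (hs : s ∈ Icc 0 (G.L e)) :
    G.flip v₀ e s ∈ Icc 0 (G.L e) := by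
  unfold flip
  split_ifs
  · exact hs
  · exact ⟨by linarith [hs.2], by linarith [hs.1]⟩

theorem abs_flip_sub_flip (v₀ : V) (e : E) (s t : ℝ) :
    |G.flip v₀ e s - G.flip v₀ e t| = |s - t| := by
  unfold flip
  split_ifs
  · rfl
  · rw [abs_sub_comm s t]; congr 1; ring

/-- The point of the edge `e` at distance `τ` from the star vertex `v₀`. -/
def radialPoint (G : MetricGraph V E) (v₀ : V) (e : E) (τ : Icc 0 (G.L e)) : G.Point :=
  G.edgePoint e ⟨G.flip v₀ e τ, flip_mem v₀ e τ.2⟩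

theorem edgePoint_eq_radialPoint (v₀ : V) (e : E) (s : Icc 0 (G.L e)) :
    G.edgePoint e s = G.radialPoint v₀ e ⟨G.flip v₀ e s, flip_mem v₀ e s.2⟩ := by
  unfold radialPoint
  congr 1
  exact Subtype.ext (flip_flip v₀ e s).symm

theorem restrict_eq_radialPoint (ψ : G.Point → ℝ) (v₀ : V) (e : E) {s : ℝ}
    (hs : s ∈ Icc 0 (G.L e)) :
    G.restrict ψ e s = ψ (G.radialPoint v₀ e ⟨G.flip v₀ e s, flip_mem v₀ e hs⟩) := by
  rw [restrict_of_mem ψ e hs, edgePoint_eq_radialPoint v₀]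

/-- The coordinate `0` on the edge `e`. -/
def startCoord (G : MetricGraph V E) (e : E) : Icc 0 (G.L e) := ⟨0, left_mem_Icc.2 (G.L_pos e).le⟩

/-- The coordinate `L e` on the edge `e`. -/
def endCoord (G : MetricGraph V E) (e : E) : Icc 0 (G.L e) :=
  ⟨G.L e, right_mem_Icc.2 (G.L_pos e).le⟩

theorem hasPath_radialPoint_self (v₀ : V) (e : E) (σ τ : Icc 0 (G.L e)) :
    G.HasPath (G.radialPoint v₀ e σ) (G.radialPoint v₀ e τ) |(σ : ℝ) - τ| := by
  have h := HasPath.step e ⟨G.flip v₀ e σ, flip_mem v₀ e σ.2⟩ ⟨G.flip v₀ e τ, flip_mem v₀ e τ.2⟩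
    _ 0 (HasPath.refl (G.radialPoint v₀ e τ))
  rwa [add_zero, abs_flip_sub_flip] at h

namespace IsStarAt

variable {v₀ : V}

theorem radialPoint_start (hG : G.IsStarAt v₀) (e : E) :
    G.radialPoint v₀ e (G.startCoord e) = G.vertex v₀ := by
  rcases hG.edge e with ⟨h1, -⟩ | ⟨h1, h2⟩
  · have := Quot.sound (Glue.origin (G := G) e)
    rw [h1] at this
    refine Eq.trans ?_ this
    unfold radialPoint edgePoint
    congr 4
    simp [flip, h1, startCoord]
  · have := Quot.sound (Glue.terminus (G := G) e)
    rw [h2] at this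
    refine Eq.trans ?_ this
    unfold radialPoint edgePoint
    congr 4
    simp [flip, h1, startCoord]

theorem radialPoint_end (hG : G.IsStarAt v₀) (e : E) :
    G.radialPoint v₀ e (G.endCoord e) = G.vertex (G.leaf v₀ e) := by
  rcases hG.edge e with ⟨h1, -⟩ | ⟨h1, h2⟩
  · refine Eq.trans ?_ ((Quot.sound (Glue.terminus (G := G) e)).trans (by simp [leaf, h1, vertex]))
    unfold radialPoint edgePoint
    congr 4
    simp [flip, h1, endCoord]
  · refine Eq.trans ?_ ((Quot.sound (Glue.origin (G := G) e)).trans (by simp [leaf, h1, vertex]))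
    unfold radialPoint edgePoint
    congr 4
    simp [flip, h1, endCoord]

theorem exists_radialPoint_eq (hG : G.IsStarAt v₀) [Nonempty E] (p : G.Point) :
    ∃ e τ, G.radialPoint v₀ e τ = p := by
  induction p using Quot.ind with
  | mk z =>
  rcases z with v | ⟨e, s⟩
  · by_cases hv : v = v₀
    · obtain ⟨e⟩ := ‹Nonempty E›
      exact ⟨e, _, (hG.radialPoint_start e).trans (by rw [hv]; rfl)⟩
    · obtain ⟨e, he, -⟩ := hG.existsUnique_leaf v hv
      exact ⟨e, _, (hG.radialPoint_end e).trans (by rw [he]; rfl)⟩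
  · exact ⟨e, _, (edgePoint_eq_radialPoint v₀ e s).symm⟩

/-- Functions on a star may be defined edge by edge. -/
theorem exists_radial_fun [Nonempty E] (hG : G.IsStarAt v₀) (F : E → ℝ → ℝ) (a : ℝ)
    (hF : ∀ e, F e 0 = a) :
    ∃ ψ : G.Point → ℝ, ∀ e (τ : Icc 0 (G.L e)), ψ (G.radialPoint v₀ e τ) = F e τ := by
  classical
  -- `ε` sends a leaf to its unique edge, which determines the value to assign to that vertex.
  choose! ε hε hεu using hG.existsUnique_leaf
  have hleaf : ∀ e, G.leaf v₀ e ≠ v₀ ∧ ε (G.leaf v₀ e) = e := fun e => by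
    have : G.leaf v₀ e ≠ v₀ := by
      rcases hG.edge e with ⟨h1, h2⟩ | ⟨h1, h2⟩ <;> simp [leaf, h1, h2]
    exact ⟨this, (hεu _ this e rfl).symm⟩
  let f : V ⊕ (Σ e : E, Icc (0 : ℝ) (G.L e)) → ℝ :=
    Sum.elim (fun v => if v = v₀ then a else F (ε v) (G.L (ε v)))
      fun z => F z.1 (G.flip v₀ z.1 z.2)
  have hf : ∀ y z, G.Glue y z → f y = f z := by
    rintro _ _ (e | e)
    · obtain ⟨hl, hε'⟩ := hleaf e
      rcases hG.edge e with ⟨h1, h2⟩ | ⟨h1, h2⟩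
      · simp [f, flip, h1, hF]
      · have : G.leaf v₀ e = G.o e := by simp [leaf, h1]
        rw [this] at hε'
        simp [f, flip, h1, hε']
    · obtain ⟨hl, hε'⟩ := hleaf e
      rcases hG.edge e with ⟨h1, h2⟩ | ⟨h1, h2⟩
      · have : G.leaf v₀ e = G.t e := by simp [leaf, h1]
        rw [this] at hε'
        simp [f, flip, h1, h2, hε']
      · simp [f, flip, h1, h2, hF]
  exact ⟨Quot.lift f hf, fun e τ => congrArg (F e) (flip_flip v₀ e τ)⟩

/-! ### Distances on a star. -/

theorem hasPath_radialPoint (hG : G.IsStarAt v₀) (e f : E) (σ : Icc 0 (G.L e)) (τ : Icc 0 (G.L f)) :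
    G.HasPath (G.radialPoint v₀ e σ) (G.radialPoint v₀ f τ) (σ + τ) := by
  have h1 := hasPath_radialPoint_self v₀ f (G.startCoord f) τ
  rw [hG.radialPoint_start, ← hG.radialPoint_start e] at h1
  have h2 := HasPath.step e ⟨G.flip v₀ e σ, flip_mem v₀ e σ.2⟩ _ _ _ h1
  rw [abs_flip_sub_flip] at h2
  simpa [startCoord, abs_of_nonneg τ.2.1, abs_of_nonneg σ.2.1] using! h2

/-- Lower bounds on distances come from functions that are 1-Lipschitz along every edge, by
induction over the segments of a path. -/
theorem abs_sub_le_dist (hG : G.IsStarAt v₀) [Nonempty E] {h : G.Point → ℝ} {F : E → ℝ → ℝ}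
    (hh : ∀ e (τ : Icc 0 (G.L e)), h (G.radialPoint v₀ e τ) = F e τ)
    (hF : ∀ e s t, |F e s - F e t| ≤ |s - t|) (p q : G.Point) : |h p - h q| ≤ G.dist p q := by
  refine le_csInf ?_ fun r hr => ?_
  · obtain ⟨e, σ, rfl⟩ := hG.exists_radialPoint_eq p
    obtain ⟨f, τ, rfl⟩ := hG.exists_radialPoint_eq q
    exact ⟨_, hG.hasPath_radialPoint e f σ τ⟩
  · have hr' : G.HasPath p q r := hr
    clear hr
    induction hr' with
    | refl => simp
    | step e a b y r _ ih =>
      have h1 : |h (G.edgePoint e a) - h (G.edgePoint e b)| ≤ |(a : ℝ) - b| := by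
        rw [edgePoint_eq_radialPoint v₀, edgePoint_eq_radialPoint v₀ e b, hh, hh,
          ← abs_flip_sub_flip v₀ e a b]
        exact hF _ _ _
      exact (abs_sub_le _ (h (G.edgePoint e b)) _).trans (add_le_add h1 ih)

theorem dist_le_of_isTopTwo (hG : G.IsStarAt v₀) [Nonempty E] {e₁ : E} {m : ℝ}
    (h : IsTopTwo G.L e₁ m) (p q : G.Point) : G.dist p q ≤ G.L e₁ + m := by
  obtain ⟨e, σ, rfl⟩ := hG.exists_radialPoint_eq p
  obtain ⟨f, τ, rfl⟩ := hG.exists_radialPoint_eq q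
  by_cases hef : e = f
  · subst hef
    refine (dist_le (hasPath_radialPoint_self v₀ e σ τ)).trans ?_
    have h1 : |(σ : ℝ) - τ| ≤ G.L e :=
      abs_sub_le_iff.2 ⟨by linarith [σ.2.2, τ.2.1], by linarith [σ.2.1, τ.2.2]⟩
    linarith [h.le e, h.nonneg G.L_pos]
  · refine (dist_le (hG.hasPath_radialPoint e f σ τ)).trans ?_
    linarith [h.add_le hef, σ.2.2, τ.2.2]

theorem add_le_dist_leaves (hG : G.IsStarAt v₀) [Nonempty E] {e f : E} (hef : e ≠ f) :
    G.L e + G.L f ≤ G.dist (G.radialPoint v₀ e (G.endCoord e))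
      (G.radialPoint v₀ f (G.endCoord f)) := by
  classical
  -- The test function is a signed distance to the centre: positive on `e`, negative on `f`, zero on
  -- the other edges.
  obtain ⟨h, hh⟩ := hG.exists_radial_fun
    (fun i τ => if i = e then τ else if i = f then -τ else 0) 0 (fun i => by split_ifs <;> simp)
  have := hG.abs_sub_le_dist
    (F := fun i τ => if i = e then τ else if i = f then -τ else 0) hh (fun i s t => by
    split_ifs
    · exact le_rfl
    · rw [abs_sub_comm]; apply le_of_eq; congr 1; ring
    · simp) (G.radialPoint v₀ e (G.endCoord e)) (G.radialPoint v₀ f (G.endCoord f))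
  rw [hh, hh] at this
  simp only [if_true, if_neg hef.symm, endCoord, sub_neg_eq_add] at this
  exact (le_abs_self _).trans this

theorem abs_sub_le_dist_radialPoint (hG : G.IsStarAt v₀) [Nonempty E] (e f : E) (σ : Icc 0 (G.L e))
    (τ : Icc 0 (G.L f)) :
    |(σ : ℝ) - τ| ≤ G.dist (G.radialPoint v₀ e σ) (G.radialPoint v₀ f τ) := by
  obtain ⟨h, hh⟩ := hG.exists_radial_fun (fun _ τ => τ) 0 (fun _ => rfl)
  have := hG.abs_sub_le_dist (F := fun _ τ => τ) hh (fun _ _ _ => le_rfl) (G.radialPoint v₀ e σ)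
    (G.radialPoint v₀ f τ)
  rwa [hh, hh] at this

/-! ### Normal derivatives in radial coordinates. -/

theorem normalDeriv_eq_sum [Fintype E] (ψ : G.Point → ℝ) (v : V) : G.normalDeriv ψ v =
    ∑ e, ((if G.t e = v then derivWithin (G.restrict ψ e) (Icc 0 (G.L e)) (G.L e) else 0) -
      (if G.o e = v then derivWithin (G.restrict ψ e) (Icc 0 (G.L e)) 0 else 0)) := by
  rw [normalDeriv, Finset.sum_filter, Finset.sum_filter, Finset.sum_sub_distrib]

theorem derivWithin_restrict {ψ : G.Point → ℝ} {F F' : E → ℝ → ℝ}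
    (hψ : ∀ e (τ : Icc 0 (G.L e)), ψ (G.radialPoint v₀ e τ) = F e τ)
    (hF : ∀ e s, HasDerivAt (F e) (F' e s) s) (e : E) {s : ℝ} (hs : s ∈ Icc 0 (G.L e)) :
    derivWithin (G.restrict ψ e) (Icc 0 (G.L e)) s =
      if G.o e = v₀ then F' e s else -F' e (G.L e - s) := by
  have hu := uniqueDiffOn_Icc (G.L_pos e) s hs
  have heq : EqOn (G.restrict ψ e) (fun x => F e (G.flip v₀ e x)) (Icc 0 (G.L e)) :=
    fun x hx => by rw [restrict_eq_radialPoint ψ v₀ e hx, hψ]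
  rw [derivWithin_congr heq (heq hs)]
  split_ifs with h
  · simp only [flip, h, if_true]
    exact (hF e s).hasDerivWithinAt.derivWithin hu
  · simp only [flip, h, if_false]
    have h1 : HasDerivAt (fun x => G.L e - x) (-1) s := by
      simpa using (hasDerivAt_id s).const_sub (G.L e)
    have h2 := (hF e (G.L e - s)).comp s h1
    rw [mul_neg_one] at h2
    exact h2.hasDerivWithinAt.derivWithin hu

theorem normalDeriv_center (hG : G.IsStarAt v₀) [Fintype E] {ψ : G.Point → ℝ} {F F' : E → ℝ → ℝ}
    (hψ : ∀ e (τ : Icc 0 (G.L e)), ψ (G.radialPoint v₀ e τ) = F e τ)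
    (hF : ∀ e s, HasDerivAt (F e) (F' e s) s) :
    G.normalDeriv ψ v₀ = -∑ e, F' e 0 := by
  rw [normalDeriv_eq_sum, ← Finset.sum_neg_distrib]
  refine Finset.sum_congr rfl fun e _ => ?_
  rw [derivWithin_restrict hψ hF e (left_mem_Icc.2 (G.L_pos e).le),
    derivWithin_restrict hψ hF e (right_mem_Icc.2 (G.L_pos e).le)]
  rcases hG.edge e with ⟨h1, h2⟩ | ⟨h1, h2⟩ <;> simp [h1, h2]

theorem normalDeriv_leaf (hG : G.IsStarAt v₀) [Fintype E] {ψ : G.Point → ℝ} {F F' : E → ℝ → ℝ}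
    (hψ : ∀ e (τ : Icc 0 (G.L e)), ψ (G.radialPoint v₀ e τ) = F e τ)
    (hF : ∀ e s, HasDerivAt (F e) (F' e s) s) {v : V} (hv : v ≠ v₀) {e : E}
    (he : G.leaf v₀ e = v) :
    G.normalDeriv ψ v = F' e (G.L e) := by
  classical
  have key : ∀ i, ((if G.t i = v then derivWithin (G.restrict ψ i) (Icc 0 (G.L i)) (G.L i) else 0) -
      (if G.o i = v then derivWithin (G.restrict ψ i) (Icc 0 (G.L i)) 0 else 0)) =
      if i = e then F' i (G.L i) else 0 := fun i => by
    rw [derivWithin_restrict hψ hF i (left_mem_Icc.2 (G.L_pos i).le),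
      derivWithin_restrict hψ hF i (right_mem_Icc.2 (G.L_pos i).le)]
    have hi : i = e ↔ G.leaf v₀ i = v :=
      ⟨fun h => h ▸ he, fun h => (hG.existsUnique_leaf v hv).unique h he⟩
    rw [if_congr hi rfl rfl]
    rcases hG.edge i with ⟨h1, h2⟩ | ⟨h1, h2⟩
    · simp [leaf, h1, hv.symm]
    · by_cases h3 : G.o i = v <;> simp [leaf, h1, h2, hv.symm, h3, hv]
  rw [normalDeriv_eq_sum, Finset.sum_congr rfl fun i _ => key i]
  simp

end IsStarAt

end MetricGraph

/-! ### Eigenfunctions on stars -/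

theorem memL2_of_eqOn {ℓ : ℝ} {u f : ℝ → ℝ} (hf : Continuous f) (hu : EqOn u f (Icc 0 ℓ)) :
    MemL2 ℓ u := by
  obtain ⟨C, hC⟩ := isCompact_Icc.exists_bound_of_continuousOn (s := Icc 0 ℓ) hf.continuousOn
  have hfL : MemLp f 2 (volume.restrict (Ioo 0 ℓ)) :=
    MemLp.of_bound hf.aestronglyMeasurable C (by
      rw [ae_restrict_iff' measurableSet_Ioo]
      exact Filter.Eventually.of_forall fun x hx => hC x (Ioo_subset_Icc_self hx))
  refine hfL.ae_eq ?_
  rw [Filter.EventuallyEq, ae_restrict_iff' measurableSet_Ioo]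
  exact Filter.Eventually.of_forall fun x hx => (hu (Ioo_subset_Icc_self hx)).symm

/-- Integration by parts. Agreement is only asked on `[0, ℓ]` because `restrict` continues functions
constantly outside. -/
theorem hasWeakDeriv_of_hasDerivAt {ℓ : ℝ} (hℓ : 0 < ℓ) {u f f' : ℝ → ℝ}
    (hf : ∀ x, HasDerivAt f (f' x) x) (hf' : Continuous f') (hu : EqOn u f (Icc 0 ℓ)) :
    HasWeakDeriv ℓ u f' := by
  intro φ hφ hφc hφs
  have hφ' : Continuous (deriv φ) := hφ.continuous_deriv (by simp)
  have h := intervalIntegral.integral_mul_deriv_eq_deriv_mul (a := 0) (b := ℓ)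
    (fun x _ => hf x) (fun x _ => (hφ.differentiable (by simp) x).hasDerivAt)
    (hf'.intervalIntegrable _ _) (hφ'.intervalIntegrable _ _)
  have h0 : φ 0 = 0 := image_eq_zero_of_notMem_tsupport fun h => (hφs h).1.false
  have h1 : φ ℓ = 0 := image_eq_zero_of_notMem_tsupport fun h => (hφs h).2.false
  rw [h0, h1, intervalIntegral.integral_of_le hℓ.le, intervalIntegral.integral_of_le hℓ.le,
    integral_Ioc_eq_integral_Ioo, integral_Ioc_eq_integral_Ioo] at h
  rw [setIntegral_congr_fun measurableSet_Ioo
    fun x hx => by simp only [hu (Ioo_subset_Icc_self hx)]; rfl]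
  simpa using h

namespace MetricGraph

variable {V E : Type*} {G : MetricGraph V E} [DecidableEq V]

/-- Both orientations of an edge are treated at once: `β ^ 2 = 1` is all that a second derivative
sees. -/
theorem exists_flip_eq (v₀ : V) (e : E) :
    ∃ α β : ℝ, β ^ 2 = 1 ∧ ∀ s, G.flip v₀ e s = α + β * s := by
  by_cases h : G.o e = v₀
  · exact ⟨0, 1, by norm_num, fun s => by simp [flip, h]⟩
  · exact ⟨G.L e, -1, by norm_num, fun s => by simp only [flip, h, if_false]; ring⟩

namespace IsStarAt

variable {v₀ : V} [Fintype E] [Nonempty E]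

theorem isEigenvalue_of_isSecular (hG : G.IsStarAt v₀) {k a : ℝ} {c : E → ℝ}
    (hs : IsSecular G.L k a c) : G.IsEigenvalue (k ^ 2) := by
  set F : E → ℝ → ℝ := fun e τ => c e * Real.cos (k * (G.L e - τ)) with hF
  set F' : E → ℝ → ℝ := fun e τ => c e * (k * Real.sin (k * (G.L e - τ))) with hF'
  have hd : ∀ e τ, HasDerivAt (F e) (F' e τ) τ := fun e τ => by
    have := ((((hasDerivAt_id τ).const_sub (G.L e)).const_mul k).cos).const_mul (c e)
    refine this.congr_deriv ?_
    simp [hF', mul_comm]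
  obtain ⟨ψ, hψ⟩ := hG.exists_radial_fun F a (fun e => by simpa [hF] using hs.cos_eq e)
  have hne : ψ ≠ 0 := by
    rintro rfl
    refine hs.ne_zero (funext fun e => ?_)
    have := hψ e (G.endCoord e)
    simpa [hF, endCoord] using this.symm
  have smooth : ∀ e, ∃ f f' : ℝ → ℝ, EqOn (G.restrict ψ e) f (Icc 0 (G.L e)) ∧
      (∀ x, HasDerivAt f (f' x) x) ∧ (∀ x, HasDerivAt f' (-(k ^ 2 * f x)) x) := by
    intro e
    obtain ⟨α, β, hβ, hflip⟩ := exists_flip_eq (G := G) v₀ e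
    have hin : ∀ x, HasDerivAt (fun x => k * (G.L e - (α + β * x))) (-(k * β)) x := fun x => by
      have := ((((hasDerivAt_id x).const_mul β).const_add α).const_sub (G.L e)).const_mul k
      simpa using! this
    refine ⟨fun x => c e * Real.cos (k * (G.L e - (α + β * x))),
      fun x => c e * (k * β) * Real.sin (k * (G.L e - (α + β * x))), fun x hx => ?_,
      fun x => ?_, fun x => ?_⟩
    · rw [restrict_eq_radialPoint ψ v₀ e hx, hψ]
      simp only [hF, hflip]
    · exact ((hin x).cos.const_mul (c e)).congr_deriv (by ring)
    · refine ((hin x).sin.const_mul (c e * (k * β))).congr_deriv ?_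
      linear_combination (-(k ^ 2 * c e * Real.cos (k * (G.L e - (α + β * x))))) * hβ
  have weak : ∀ e, MemL2 (G.L e) (G.restrict ψ e) ∧ ∃ g, MemL2 (G.L e) g ∧
      HasWeakDeriv (G.L e) (G.restrict ψ e) g ∧ ∃ h, MemL2 (G.L e) h ∧ HasWeakDeriv (G.L e) g h ∧
      HasWeakSecondDeriv (G.L e) (G.restrict ψ e) fun x => -(k ^ 2 * G.restrict ψ e x) := by
    intro e
    obtain ⟨f, f', h1, h2, h3⟩ := smooth e
    have hfc : Continuous f := continuous_iff_continuousAt.2 fun x => (h2 x).continuousAt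
    have hfc' : Continuous f' := continuous_iff_continuousAt.2 fun x => (h3 x).continuousAt
    have hfc'' : Continuous fun x => -(k ^ 2 * f x) := by fun_prop
    have w1 := hasWeakDeriv_of_hasDerivAt (G.L_pos e) h2 hfc' h1
    have w2 := hasWeakDeriv_of_hasDerivAt (G.L_pos e) h3 hfc'' (fun x _ => rfl)
    have h1'' : EqOn (fun x => -(k ^ 2 * G.restrict ψ e x)) (fun x => -(k ^ 2 * f x))
        (Icc 0 (G.L e)) := fun x hx => by simp only [h1 hx]
    have m1 := memL2_of_eqOn (ℓ := G.L e) hfc' (fun x _ => rfl)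
    refine ⟨memL2_of_eqOn hfc h1, f', m1, w1, _, memL2_of_eqOn hfc'' (fun x _ => rfl), w2,
      memL2_of_eqOn hfc'' h1'', f', m1, w1, fun φ h h' h'' => ?_⟩
    rw [w2 φ h h' h'']
    congr 1
    refine setIntegral_congr_fun measurableSet_Ioo fun x hx => ?_
    simp only [h1 (Ioo_subset_Icc_self hx)]
  refine ⟨ψ, hne, ⟨⟨⟨fun e => ?_, fun e => ?_⟩, fun e => ?_, fun v => ?_⟩, fun e => ?_⟩⟩
  · obtain ⟨h1, g, h2, h3, -⟩ := weak e
    exact ⟨h1, g, h3, h2⟩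
  · obtain ⟨f, f', h1, h2, -⟩ := smooth e
    exact (continuous_iff_continuousAt.2 fun x => (h2 x).continuousAt).continuousOn.congr h1
  · obtain ⟨h1, g, h2, h3, h, h4, h5, -⟩ := weak e
    exact ⟨h1, g, h3, h2, h, h5, h4⟩
  · by_cases hv : v = v₀
    · rw [hv, hG.normalDeriv_center hψ hd, neg_eq_zero]
      have : ∀ e, F' e 0 = k * (c e * Real.sin (k * G.L e)) := fun e => by
        simp only [hF', sub_zero]; ring
      rw [Finset.sum_congr rfl fun e _ => this e, ← Finset.mul_sum, hs.sum_sin, mul_zero]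
    · obtain ⟨e, he, -⟩ := hG.existsUnique_leaf v hv
      rw [hG.normalDeriv_leaf hψ hd hv he]
      simp [hF']
  · obtain ⟨-, g, -, -, h, -, -, h6⟩ := weak e
    exact h6

theorem exists_isSecular_of_memKer (hG : G.IsStarAt v₀) {k : ℝ} (hk : 0 < k) {ψ : G.Point → ℝ}
    (hne : ψ ≠ 0) (hψ : G.MemKer (k ^ 2) ψ) :
    ∃ a c, IsSecular G.L k a c ∧ ∀ e (τ : Icc 0 (G.L e)),
      ψ (G.radialPoint v₀ e τ) = c e * Real.cos (k * (G.L e - τ)) := by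
  obtain ⟨⟨⟨-, hC⟩, -, hN⟩, hW⟩ := hψ
  have hedge : ∀ e, ∃ c d : ℝ, ∀ τ : Icc 0 (G.L e), ψ (G.radialPoint v₀ e τ) =
      c * Real.cos (k * (G.L e - τ)) + d * Real.sin (k * (G.L e - τ)) := by
    intro e
    obtain ⟨A, B, hAB⟩ := (hW e).exists_eq_cos_add_sin (G.L_pos e) hk (hC e)
    have h : ∀ τ : Icc 0 (G.L e), ψ (G.radialPoint v₀ e τ) =
        A * Real.cos (k * G.flip v₀ e τ) + B * Real.sin (k * G.flip v₀ e τ) := fun τ => by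
      rw [← hAB _ (flip_mem v₀ e τ.2), restrict_of_mem ψ e (flip_mem v₀ e τ.2)]
      rfl
    by_cases ho : G.o e = v₀
    -- These coefficients re-expand the solution around the leaf, through `k τ = k L - k (L - τ)`.
    · refine ⟨A * Real.cos (k * G.L e) + B * Real.sin (k * G.L e),
        A * Real.sin (k * G.L e) - B * Real.cos (k * G.L e), fun τ => ?_⟩
      rw [h]
      have : k * G.flip v₀ e τ = k * G.L e - k * (G.L e - τ) := by
        simp only [flip, ho, if_true]; ring
      rw [this, Real.cos_sub, Real.sin_sub]
      ring
    · refine ⟨A, B, fun τ => ?_⟩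
      rw [h]
      simp only [flip, ho, if_false]
  choose c d hcd using hedge
  set F : E → ℝ → ℝ := fun e τ =>
    c e * Real.cos (k * (G.L e - τ)) + d e * Real.sin (k * (G.L e - τ)) with hF
  set F' : E → ℝ → ℝ := fun e τ =>
    k * (c e * Real.sin (k * (G.L e - τ)) - d e * Real.cos (k * (G.L e - τ))) with hF'
  have hd : ∀ e τ, HasDerivAt (F e) (F' e τ) τ := fun e τ => by
    have hin := ((hasDerivAt_id τ).const_sub (G.L e)).const_mul k
    refine ((hin.cos.const_mul (c e)).add (hin.sin.const_mul (d e))).congr_deriv ?_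
    simp only [hF', id]
    ring
  -- The Kirchhoff condition at a leaf is a Neumann condition and removes the sine term.
  have hd0 : ∀ e, d e = 0 := fun e => by
    have hl : G.leaf v₀ e ≠ v₀ := by
      rcases hG.edge e with ⟨h1, h2⟩ | ⟨h1, h2⟩ <;> simp [leaf, h1, h2]
    have := hN (G.leaf v₀ e)
    rw [hG.normalDeriv_leaf (F := F) hcd hd hl rfl] at this
    simpa [hF', hk.ne'] using this
  have hcos : ∀ e (τ : Icc 0 (G.L e)),
      ψ (G.radialPoint v₀ e τ) = c e * Real.cos (k * (G.L e - τ)) := fun e τ => by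
    rw [hcd, hd0]; ring
  refine ⟨ψ (G.vertex v₀), c, ⟨?_, fun e => ?_, ?_⟩, hcos⟩
  · rintro rfl
    refine hne (funext fun p => ?_)
    obtain ⟨e, τ, rfl⟩ := hG.exists_radialPoint_eq p
    simp [hcos]
  · rw [← hG.radialPoint_start e, hcos]
    simp [startCoord]
  · have := hN v₀
    rw [hG.normalDeriv_center (F := F) hcd hd, neg_eq_zero] at this
    have h2 : ∀ e, F' e 0 = k * (c e * Real.sin (k * G.L e)) := fun e => by
      simp only [hF', hd0, sub_zero]; ring
    rw [Finset.sum_congr rfl fun e _ => h2 e, ← Finset.mul_sum] at this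
    exact (mul_eq_zero.1 this).resolve_left hk.ne'

/-- The lower bound on all positive eigenvalues makes the infimum positive, and one explicit
eigenvalue bounds it above. Attainment of the infimum plays no role. -/
theorem mu2_bounds (hG : G.IsStarAt v₀) {e₁ : E} {m : ℝ} (h : IsTopTwo G.L e₁ m) :
    0 < G.mu2 ∧ Real.sqrt G.mu2 * (G.L e₁ + m) ≤ Real.pi := by
  have hL1 := G.L_pos e₁
  have hm := h.nonneg G.L_pos
  have hlow : ∀ μ ∈ {μ : ℝ | 0 < μ ∧ G.IsEigenvalue μ}, (Real.pi / 2 / G.L e₁) ^ 2 ≤ μ := by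
    rintro μ ⟨hμ, ψ, hne, hψ⟩
    have hk : 0 < Real.sqrt μ := Real.sqrt_pos.2 hμ
    rw [← Real.sq_sqrt hμ.le] at hψ
    obtain ⟨a, c, hs, -⟩ := hG.exists_isSecular_of_memKer hk hne hψ
    have := h.pi_div_two_le_of_isSecular G.L_pos hk hs
    rw [← Real.sq_sqrt hμ.le]
    exact pow_le_pow_left₀ (by positivity) ((div_le_iff₀ hL1).2 this) 2
  obtain ⟨k, a, c, hk, hkD, hs⟩ := h.exists_isSecular G.L_pos
  have hmem : k ^ 2 ∈ {μ : ℝ | 0 < μ ∧ G.IsEigenvalue μ} :=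
    ⟨by positivity, hG.isEigenvalue_of_isSecular hs⟩
  refine ⟨lt_of_lt_of_le (by positivity) (le_csInf ⟨_, hmem⟩ hlow), ?_⟩
  have h1 : G.mu2 ≤ k ^ 2 := csInf_le ⟨_, hlow⟩ hmem
  have h2 : Real.sqrt G.mu2 ≤ k := Real.sqrt_le_iff.2 ⟨hk.le, h1⟩
  exact (mul_le_mul_of_nonneg_right h2 (by linarith)).trans hkD

end IsStarAt

end MetricGraph

/-! ### Location of the extrema -/

namespace IsSecular

variable {E : Type*} [Fintype E] {L : E → ℝ} {k a : ℝ} {c : E → ℝ}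

theorem neg (hs : IsSecular L k a c) : IsSecular L k (-a) (-c) where
  ne_zero := neg_ne_zero.2 hs.ne_zero
  cos_eq e := by rw [← hs.cos_eq e]; simp
  sum_sin := by simpa using hs.sum_sin

/-- Here `a = 0`, so `c` lives on the edges of maximal length and sums to zero; it takes both signs.
All cosines lie in `[0, 1]` and equal `1` only at leaves. -/
theorem extrema_of_eq_pi_div_two (hs : IsSecular L k a c) (hL : ∀ e, 0 < L e) (hk : 0 < k)
    {e₁ : E} {m : ℝ} (h : IsTopTwo L e₁ m) (h1 : k * L e₁ = Real.pi / 2)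
    {e f : E} {σ τ : ℝ} (hσ : σ ∈ Icc 0 (L e)) (hτ : τ ∈ Icc 0 (L f))
    (hmax : ∀ i, ∀ t ∈ Icc 0 (L i),
      c i * Real.cos (k * (L i - t)) ≤ c e * Real.cos (k * (L e - σ)))
    (hmin : ∀ i, ∀ t ∈ Icc 0 (L i),
      c f * Real.cos (k * (L f - τ)) ≤ c i * Real.cos (k * (L i - t))) :
    e ≠ f ∧ σ = L e ∧ τ = L f ∧ L e₁ + m ≤ L e + L f := by
  have hπ := Real.pi_pos
  have ha : a = 0 := by rw [← hs.cos_eq e₁, h1, Real.cos_pi_div_two, mul_zero]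
  have hzero : ∀ i, c i ≠ 0 → L i = L e₁ := fun i hi => by
    by_contra hne
    have hlt : k * L i < Real.pi / 2 := by
      rw [← h1]; exact mul_lt_mul_of_pos_left (lt_of_le_of_ne (h.le i) hne) hk
    have hcos : 0 < Real.cos (k * L i) :=
      Real.cos_pos_of_mem_Ioo ⟨by have := mul_pos hk (hL i); linarith, hlt⟩
    have := hs.cos_eq i
    rw [ha] at this
    exact (mul_ne_zero hi hcos.ne') this
  have hsum : ∑ i, c i = 0 := by
    rw [← hs.sum_sin]
    refine Finset.sum_congr rfl fun i _ => ?_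
    by_cases hi : c i = 0
    · simp [hi]
    · rw [hzero i hi, h1, Real.sin_pi_div_two, mul_one]
  obtain ⟨i₀, hi₀⟩ := Function.ne_iff.1 hs.ne_zero
  obtain ⟨p, -, hp⟩ := Finset.exists_pos_of_sum_zero_of_exists_nonzero c hsum
    ⟨i₀, Finset.mem_univ _, hi₀⟩
  obtain ⟨n, -, hn⟩ := Finset.exists_pos_of_sum_zero_of_exists_nonzero (fun i => -c i)
    (by simpa using hsum) ⟨i₀, Finset.mem_univ _, by simpa using hi₀⟩
  have hang : ∀ i, ∀ t ∈ Icc 0 (L i), 0 ≤ k * (L i - t) ∧ k * (L i - t) ≤ Real.pi / 2 :=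
    fun i t ht => ⟨mul_nonneg hk.le (by linarith [ht.2]), by
      rw [← h1]; exact mul_le_mul_of_nonneg_left (by linarith [ht.1, h.le i]) hk.le⟩
  have hcos0 : ∀ i, ∀ t ∈ Icc 0 (L i), 0 ≤ Real.cos (k * (L i - t)) := fun i t ht =>
    Real.cos_nonneg_of_mem_Icc ⟨by linarith [(hang i t ht).1], (hang i t ht).2⟩
  have hcos1 : ∀ i, ∀ t ∈ Icc 0 (L i), 1 ≤ Real.cos (k * (L i - t)) → t = L i :=
    fun i t ht h => by
      have := (Real.cos_eq_one_iff_of_lt_of_lt (by linarith [(hang i t ht).1])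
        (by linarith [(hang i t ht).2])).1 (le_antisymm (Real.cos_le_one _) h)
      have := (mul_eq_zero.1 this).resolve_left hk.ne'
      linarith
  have hend : ∀ i, L i ∈ Icc 0 (L i) := fun i => ⟨(hL i).le, le_rfl⟩
  have hce : 0 < c e := by
    have h2 := hmax p (L p) (hend p)
    simp only [sub_self, mul_zero, Real.cos_zero, mul_one] at h2
    exact pos_of_mul_pos_left (hp.trans_le h2) (hcos0 e σ hσ)
  have hcf : c f < 0 := by
    have h2 := hmin n (L n) (hend n)
    simp only [sub_self, mul_zero, Real.cos_zero, mul_one] at h2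
    have := hcos0 f τ hτ
    by_contra! h3
    have := mul_nonneg h3 this
    linarith
  have hef : e ≠ f := by rintro rfl; linarith
  refine ⟨hef, hcos1 e σ hσ ?_, hcos1 f τ hτ ?_, ?_⟩
  · have h2 := hmax e (L e) (hend e)
    simp only [sub_self, mul_zero, Real.cos_zero] at h2
    exact le_of_mul_le_mul_left h2 hce
  · have h2 := hmin f (L f) (hend f)
    simp only [sub_self, mul_zero, Real.cos_zero] at h2
    exact (mul_le_mul_left_of_neg hcf).1 h2
  · rw [hzero e hce.ne', hzero f hcf.ne]
    linarith [h.le_first]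

/-- Only the longest edge has a negative cosine at the centre, so for `a > 0` its coefficient alone
is negative. The second alternative is the single edge, with its maximum at the centre. -/
theorem extrema_of_pi_div_two_lt (hs : IsSecular L k a c) (hL : ∀ e, 0 < L e) (hk : 0 < k)
    {e₁ : E} {m : ℝ} (h : IsTopTwo L e₁ m) (h1 : Real.pi / 2 < k * L e₁)
    (hD : k * (L e₁ + m) ≤ Real.pi) (ha : 0 ≤ a)
    {e f : E} {σ τ : ℝ} (hσ : σ ∈ Icc 0 (L e)) (hτ : τ ∈ Icc 0 (L f))
    (hmax : ∀ i, ∀ t ∈ Icc 0 (L i),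
      c i * Real.cos (k * (L i - t)) ≤ c e * Real.cos (k * (L e - σ)))
    (hmin : ∀ i, ∀ t ∈ Icc 0 (L i),
      c f * Real.cos (k * (L f - τ)) ≤ c i * Real.cos (k * (L i - t))) :
    (e ≠ f ∧ σ = L e ∧ τ = L f ∧ L e₁ + m ≤ L e + L f) ∨ (L e₁ + m ≤ τ - σ) := by
  have hπ := Real.pi_pos
  have hm := h.nonneg hL
  have hkm : k * m < Real.pi / 2 := by linarith [mul_add k (L e₁) m]
  have hk1 : k * L e₁ ≤ Real.pi := by linarith [mul_add k (L e₁) m, mul_nonneg hk.le hm]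
  have hsmall : ∀ i, i ≠ e₁ → 0 < k * L i ∧ k * L i < Real.pi / 2 := fun i hi =>
    ⟨mul_pos hk (hL i), (mul_le_mul_of_nonneg_left (h.le_second i hi) hk.le).trans_lt hkm⟩
  have hang : ∀ i, ∀ t ∈ Icc 0 (L i), 0 ≤ k * (L i - t) ∧ k * (L i - t) ≤ k * L i :=
    fun i t ht => ⟨mul_nonneg hk.le (by linarith [ht.2]),
      mul_le_mul_of_nonneg_left (by linarith [ht.1]) hk.le⟩
  have hcosL : ∀ i, i ≠ e₁ → 0 < Real.cos (k * L i) := fun i hi =>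
    Real.cos_pos_of_mem_Ioo ⟨by linarith [(hsmall i hi).1], (hsmall i hi).2⟩
  have hcos1 : Real.cos (k * L e₁) < 0 := Real.cos_neg_of_pi_div_two_lt_of_lt h1 (by linarith)
  have hend : ∀ i, L i ∈ Icc 0 (L i) := fun i => ⟨(hL i).le, le_rfl⟩
  have hle : ∀ i, k * L i ≤ Real.pi := fun i =>
    (mul_le_mul_of_nonneg_left (h.le i) hk.le).trans hk1
  have hone : ∀ i, ∀ t ∈ Icc 0 (L i), 1 ≤ Real.cos (k * (L i - t)) → t = L i :=
    fun i t ht h => by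
      have := (Real.cos_eq_one_iff_of_lt_of_lt (by linarith [(hang i t ht).1])
        (by linarith [(hang i t ht).2, hle i])).1 (le_antisymm (Real.cos_le_one _) h)
      have := (mul_eq_zero.1 this).resolve_left hk.ne'
      linarith
  have ha' : 0 < a := by
    refine lt_of_le_of_ne ha fun ha0 => hs.ne_zero (funext fun i => ?_)
    have h2 := hs.cos_eq i
    rw [← ha0] at h2
    refine (mul_eq_zero.1 h2).resolve_right ?_
    by_cases hi : i = e₁
    · rw [hi]; exact hcos1.ne
    · exact (hcosL i hi).ne'
  have hc1 : c e₁ < 0 := by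
    by_contra! h2
    have := mul_nonpos_of_nonneg_of_nonpos h2 hcos1.le
    linarith [hs.cos_eq e₁]
  have hc : ∀ i, i ≠ e₁ → 0 < c i := fun i hi => by
    refine pos_of_mul_pos_left ?_ (hcosL i hi).le
    rw [hs.cos_eq i]; exact ha'
  -- On the other edges the function is nonnegative, while it is `c e₁ < 0` at the leaf of `e₁`.
  have hf : f = e₁ := by
    by_contra hf
    have h2 := hmin e₁ (L e₁) (hend e₁)
    simp only [sub_self, mul_zero, Real.cos_zero, mul_one] at h2
    have h3 : 0 ≤ Real.cos (k * (L f - τ)) := Real.cos_nonneg_of_mem_Icc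
      ⟨by linarith [(hang f τ hτ).1], by linarith [(hang f τ hτ).2, hsmall f hf]⟩
    linarith [mul_nonneg (hc f hf).le h3]
  subst hf
  have hτL : τ = L f := hone f τ hτ (by
    have h2 := hmin f (L f) (hend f)
    simp only [sub_self, mul_zero, Real.cos_zero] at h2
    exact (mul_le_mul_left_of_neg hc1).1 h2)
  have hanti : ∀ σ ∈ Icc 0 (L f), Real.cos (k * L f) ≤ Real.cos (k * (L f - σ)) := fun t ht =>
    Real.cos_le_cos_of_nonneg_of_le_pi (hang f t ht).1 hk1 (hang f t ht).2
  have hval1 : ∀ t ∈ Icc 0 (L f), c f * Real.cos (k * (L f - t)) ≤ a := fun t ht => by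
    rw [← hs.cos_eq f]; exact mul_le_mul_of_nonpos_left (hanti t ht) hc1.le
  rcases h.second with ⟨hm0, hall⟩ | ⟨e₂, h21, h2m⟩
  · right
    have he := hall e
    subst he
    have h2 := hmax e 0 ⟨le_rfl, (hL e).le⟩
    rw [sub_zero] at h2
    have h3 : Real.cos (k * (L e - σ)) ≤ Real.cos (k * L e) := (mul_le_mul_left_of_neg hc1).1 h2
    have h4 := Real.injOn_cos ⟨(hang e σ hσ).1, (hang e σ hσ).2.trans hk1⟩
      ⟨(mul_pos hk (hL e)).le, hk1⟩ (le_antisymm h3 (hanti σ hσ))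
    have := mul_left_cancel₀ hk.ne' h4
    linarith
  · left
    have hpos2 := hsmall e₂ h21
    have h2 := hmax e₂ (L e₂) (hend e₂)
    simp only [sub_self, mul_zero, Real.cos_zero, mul_one] at h2
    -- Values on the longest edge are at most `a`, so this strict inequality keeps the maximum off
    -- that edge.
    have ha2 : a < c e₂ := by
      have h3 : Real.cos (k * L e₂) < 1 := by
        rw [← Real.cos_zero]
        exact Real.cos_lt_cos_of_nonneg_of_le_pi le_rfl (hle e₂) hpos2.1
      rw [← hs.cos_eq e₂]
      nlinarith [hc e₂ h21]
    have he : e ≠ f := by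
      rintro rfl
      linarith [hval1 σ hσ]
    have hce := hc e he
    have hcmp : Real.cos (k * L e₂) ≤ Real.cos (k * L e) :=
      Real.cos_le_cos_of_nonneg_of_le_pi (mul_pos hk (hL e)).le (hle e₂)
        (mul_le_mul_of_nonneg_left ((h.le_second e he).trans h2m.ge) hk.le)
    have hcc : c e ≤ c e₂ := by
      have h3 : c e * Real.cos (k * L e₂) ≤ c e₂ * Real.cos (k * L e₂) := by
        rw [hs.cos_eq e₂, ← hs.cos_eq e]
        exact mul_le_mul_of_nonneg_left hcmp hce.le
      exact le_of_mul_le_mul_right h3 (hcosL e₂ h21)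
    have hle1 := Real.cos_le_one (k * (L e - σ))
    -- The chain `c e₂ ≤ c e * cos ≤ c e ≤ c e₂` collapses to equalities.
    have hceq : c e = c e₂ := by nlinarith
    refine ⟨he, hone e σ hσ ?_, hτL, ?_⟩
    · rw [← hceq] at h2
      exact le_of_mul_le_mul_left (by linarith) hce
    · have h3 : Real.cos (k * L e) = Real.cos (k * L e₂) := by
        refine mul_left_cancel₀ hce.ne' ?_
        rw [hs.cos_eq e, hceq, hs.cos_eq e₂]
      have h4 := Real.injOn_cos ⟨(mul_pos hk (hL e)).le, hle e⟩ ⟨hpos2.1.le, hle e₂⟩ h3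
      have := mul_left_cancel₀ hk.ne' h4
      linarith

theorem extrema (hs : IsSecular L k a c) (hL : ∀ e, 0 < L e) (hk : 0 < k)
    {e₁ : E} {m : ℝ} (h : IsTopTwo L e₁ m) (hD : k * (L e₁ + m) ≤ Real.pi)
    {e f : E} {σ τ : ℝ} (hσ : σ ∈ Icc 0 (L e)) (hτ : τ ∈ Icc 0 (L f))
    (hmax : ∀ i, ∀ t ∈ Icc 0 (L i),
      c i * Real.cos (k * (L i - t)) ≤ c e * Real.cos (k * (L e - σ)))
    (hmin : ∀ i, ∀ t ∈ Icc 0 (L i),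
      c f * Real.cos (k * (L f - τ)) ≤ c i * Real.cos (k * (L i - t))) :
    (e ≠ f ∧ σ = L e ∧ τ = L f ∧ L e₁ + m ≤ L e + L f) ∨ L e₁ + m ≤ |σ - τ| := by
  rcases (h.pi_div_two_le_of_isSecular hL hk hs).eq_or_lt with h1 | h1
  · exact Or.inl (hs.extrema_of_eq_pi_div_two hL hk h h1.symm hσ hτ hmax hmin)
  rcases le_total 0 a with ha | ha
  · rcases hs.extrema_of_pi_div_two_lt hL hk h h1 hD ha hσ hτ hmax hmin with h2 | h2
    · exact Or.inl h2
    · right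
      rw [abs_sub_comm]
      exact h2.trans (le_abs_self _)
  -- Changing the sign of the function makes the central value nonnegative and swaps maximum and
  -- minimum.
  · rcases hs.neg.extrema_of_pi_div_two_lt hL hk h h1 hD (neg_nonneg.2 ha) hτ hσ
      (fun i t ht => by simpa using hmin i t ht) (fun i t ht => by simpa using hmax i t ht)
      with ⟨h2, h3, h4, h5⟩ | h2
    · exact Or.inl ⟨h2.symm, h4, h3, by linarith⟩
    · exact Or.inr (h2.trans (le_abs_self _))

end IsSecular

/-! ### The diameter and the conclusion. -/

namespace MetricGraph

variable {V E : Type*} {G : MetricGraph V E}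

theorem isGreatest_distances_of_forall_dist_le {D : ℝ} (hle : ∀ p q, G.dist p q ≤ D)
    {x y : G.Point} (hxy : D ≤ G.dist x y) :
    IsGreatest G.distances G.diam ∧ G.dist x y = G.diam := by
  have hD : G.dist x y = D := le_antisymm (hle x y) hxy
  have hgr : IsGreatest G.distances D := by
    refine ⟨⟨x, y, hD.symm⟩, ?_⟩
    rintro _ ⟨p, q, rfl⟩
    exact hle p q
  have hdiam : G.diam = D := hgr.csSup_eq
  exact ⟨hdiam.symm ▸ hgr, hD.trans hdiam.symm⟩

theorem IsStarAt.subsingleton_point [DecidableEq V] [IsEmpty E] {v₀ : V} (hG : G.IsStarAt v₀) :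
    ∀ p : G.Point, p = G.vertex v₀ := by
  intro p
  induction p using Quot.ind with
  | mk z =>
  rcases z with v | ⟨e, -⟩
  · by_cases hv : v = v₀
    · rw [hv]; rfl
    · obtain ⟨e, -⟩ := hG.existsUnique_leaf v hv
      exact isEmptyElim e
  · exact (IsEmpty.false e).elim

theorem IsStarAt.le_dist_extrema [DecidableEq V] [Fintype E] [Nonempty E] {v₀ : V}
    (hG : G.IsStarAt v₀) {e₁ : E} {m : ℝ} (h : IsTopTwo G.L e₁ m) {ψ : G.Point → ℝ} (hψ : ψ ≠ 0)
    (hker : G.MemKer G.mu2 ψ) {x y : G.Point} (hx : ∀ z, ψ z ≤ ψ x) (hy : ∀ z, ψ y ≤ ψ z) :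
    G.L e₁ + m ≤ G.dist x y := by
  obtain ⟨hμ, hD⟩ := hG.mu2_bounds h
  have hk : 0 < Real.sqrt G.mu2 := Real.sqrt_pos.2 hμ
  rw [← Real.sq_sqrt hμ.le] at hker
  obtain ⟨a, c, hs, hc⟩ := hG.exists_isSecular_of_memKer hk hψ hker
  obtain ⟨e, σ, rfl⟩ := hG.exists_radialPoint_eq x
  obtain ⟨f, τ, rfl⟩ := hG.exists_radialPoint_eq y
  rcases hs.extrema G.L_pos hk h hD σ.2 τ.2
    (fun i t ht => by rw [← hc e σ]; exact (hc i ⟨t, ht⟩).symm.trans_le (hx _))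
    (fun i t ht => by rw [← hc f τ]; exact (hy _).trans_eq (hc i ⟨t, ht⟩))
    with ⟨hef, hσ, hτ, hle⟩ | hle
  · have h1 : σ = G.endCoord e := Subtype.ext hσ
    have h2 : τ = G.endCoord f := Subtype.ext hτ
    rw [h1, h2]
    exact hle.trans (hG.add_le_dist_leaves hef)
  · exact hle.trans (hG.abs_sub_le_dist_radialPoint e f σ τ)

end MetricGraph

theorem proposition4p8 {V E : Type*} [Fintype V] [DecidableEq V] [Fintype E]
    (G : MetricGraph V E) (hG : G.IsStar)
    (ψ : G.Point → ℝ) (hψ : ψ ≠ 0) (hker : G.MemKer G.mu2 ψ)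
    (x y : G.Point) (hx : ∀ z, ψ z ≤ ψ x) (hy : ∀ z, ψ y ≤ ψ z) :
    IsGreatest G.distances G.diam ∧ G.dist x y = G.diam := by
  obtain ⟨v₀, hG⟩ := hG.exists_isStarAt
  rcases isEmpty_or_nonempty E with hE | hE
  -- `IsStar` admits the graph without edges, which is a single point.
  · refine MetricGraph.isGreatest_distances_of_forall_dist_le (D := G.dist x y)
      (fun p q => ?_) le_rfl
    rw [hG.subsingleton_point p, hG.subsingleton_point q, hG.subsingleton_point x,
      hG.subsingleton_point y]
  · obtain ⟨e₁, m, h⟩ := exists_isTopTwo G.L_pos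
    exact MetricGraph.isGreatest_distances_of_forall_dist_le (hG.dist_le_of_isTopTwo h)
      (hG.le_dist_extrema h hψ hker hx hy)
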